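/- Let $H$ be a complex Hilbert space with inner product $(\cdot,\cdot)$ and let $L_b(H)$ be the algebra of bounded linear operators on $H$. An operator $S\in L_b(H)$ is of trace class, $S\in L^1(H)$, if $\sum_{e\in E}\big\| |S|^{1/2}e\big\|^2<\infty$ for an orthonormal basis $E$ of $H$, where $|S|=(S^*S)^{1/2}$; its trace is then $\operatorname{tr}(S)=\sum_{e\in E}(Se,e)$ (neither notion depends on the choice of $E$). Consider the following locally convex topologies on $L_b(H)$: - the strong operator topology $\mathcal T_s$, induced by the seminorms $T\mapsto\|Tx\|$, $x\in H$; - the weak operator topology $\mathcal T_w$, induced by the seminorms $T\mapsto|(Tx,y)|$, $x,y\in H$; - the ultraweak operator topology $\mathcal T_{uw}$, induced by the seminorms $T\mapsto|\operatorname{tr}(ST)|$, $S\in L^1(H)$ (equivalently, the coarsest topology making all functionals $T\mapsto\operatorname{tr}(ST)$, $S\in L^1(H)$, continuous). Let $A$ be a $*$-subalgebra of $L_b(H)$, i.e. a linear subspace closed under multiplication and under $T\mapsto T^*$, not necessarily containing the identity operator. Then the following statements are equivalent: 1. $A$ is closed with respect to $\mathcal T_s$. 2. $A$ is closed with respect to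 $\mathcal T_w$. 3. $A$ is closed with respect to $\mathcal T_{uw}$. -/

import Mathlib

open Topology

namespace OperatorTopology

noncomputable section

variable (H : Type*) [NormedAddCommGroup H] [InnerProductSpace ℂ H] [CompleteSpace H]

/-- The index set of a fixed orthonormal basis of `H`. -/
def basisIndex : Set H := (exists_hilbertBasis ℂ H).choose

/-- A fixed orthonormal basis of the Hilbert space `H`. The notions below (Hilbert-Schmidt
operator, trace class operator, trace) do not depend on the choice of the orthonormal basis. -/
def basis : HilbertBasis (basisIndex H) ℂ H := (exists_hilbertBasis ℂ H).choose_spec.choose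

variable {H}

/-- `S` is a Hilbert-Schmidt operator: `∑ ‖S e‖ ^ 2 < ∞`, the sum running over an orthonormal
basis. -/
def IsHilbertSchmidt (S : H →L[ℂ] H) : Prop :=
  Summable fun i : basisIndex H => ‖S (basis H i)‖ ^ 2

/-- `S` is a trace class operator: `|S| ^ (1/2)` is a Hilbert-Schmidt operator, where
`|S| = (S* S) ^ (1/2)`. -/
def IsTraceClass (S : H →L[ℂ] H) : Prop :=
  IsHilbertSchmidt (CFC.sqrt (CFC.abs S))

/-- The trace `∑ (S e, e)` over an orthonormal basis; the series converges absolutely if `S` is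
of trace class. Mathlib's inner product is linear in the second variable, so `(S e, e)` reads
`inner ℂ e (S e)`. -/
def trace (S : H →L[ℂ] H) : ℂ :=
  ∑' i : basisIndex H, inner ℂ (basis H i) (S (basis H i))

variable (H)

/-- The strong operator topology, i.e. the topology of pointwise convergence in norm. -/
abbrev strong : TopologicalSpace (H →L[ℂ] H) :=
  TopologicalSpace.induced (ContinuousLinearMap.toPointwiseConvergenceCLM ℂ (RingHom.id ℂ) H H)
    inferInstance

/-- The weak operator topology. -/
abbrev weak : TopologicalSpace (H →L[ℂ] H) :=
  TopologicalSpace.induced (ContinuousLinearMapWOT.ofCLM : (H →L[ℂ] H) → (H →WOT[ℂ] H)) inferInstance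

/-- The ultraweak operator topology: the topology induced by the functionals `T ↦ tr (S T)`, or
equivalently by the seminorms `T ↦ |tr (S T)|`, where `S` runs through the trace class
operators. -/
abbrev ultraweak : TopologicalSpace (H →L[ℂ] H) :=
  TopologicalSpace.induced
    (fun (T : H →L[ℂ] H) (S : {S : H →L[ℂ] H // IsTraceClass S}) => trace ((S : H →L[ℂ] H) * T))
    Pi.topologicalSpace

end

end OperatorTopology

namespace OperatorTopology

/-! ### Amplifications and a density theorem for degenerate *-algebras -/

noncomputable section

/-! All three closures of `A` contain every `T` satisfying the matrix-coefficient identities valid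
on `A`, and the weak closure contains only such `T`. So strong or ultraweak closedness forces weak
closedness; the converses hold because the weak topology is the coarsest. The density argument is
von Neumann's. Let `P` project onto the closure of `A x` in a Hilbert sum of copies of `H`. The
amplification of `A` commutes with `P`, and `a x = P a x = a P x` on `A`. Read componentwise these
are coefficient identities, so they pass to `T`: `T x = T P x = P T x` lies in the closure of `A x`.
No unit is needed. Finite sums give strong density; infinite sums, with a Hilbert-Schmidt bound on
the trace, give ultraweak density. -/

theorem memℓp_two_iff {H : Type*} [NormedAddCommGroup H] {ι : Type*} {f : ι → H} : Memℓp f 2 ↔ Summable fun i => ‖f i‖ ^ 2 := by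
  simpa using memℓp_gen_iff (p := 2) (f := f) (by norm_num)

theorem hasSum_norm_sq {H : Type*} [NormedAddCommGroup H] {ι : Type*} (x : lp (fun _ : ι => H) 2) :
    HasSum (fun i => ‖x i‖ ^ 2) (‖x‖ ^ 2) := by
  simpa using lp.hasSum_norm (p := 2) (by norm_num) x

variable {H : Type*} [NormedAddCommGroup H] [InnerProductSpace ℂ H]

/-- The amplification of an operator on `H` to the Hilbert sum of copies of `H`, acting
componentwise. -/
def amplification (ι : Type*) (T : H →L[ℂ] H) :
    lp (fun _ : ι => H) 2 →L[ℂ] lp (fun _ : ι => H) 2 :=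
  LinearMap.mkContinuous
    { toFun := fun x => ⟨fun i => T (x i), memℓp_two_iff.2 <|
        Summable.of_nonneg_of_le (fun _ => by positivity)
          (fun i => (pow_le_pow_left₀ (norm_nonneg _) (T.le_opNorm (x i)) 2).trans_eq
            (mul_pow _ _ _))
          ((hasSum_norm_sq x).summable.mul_left (‖T‖ ^ 2))⟩
      map_add' := fun x y => by ext i; exact map_add T (x i) (y i)
      map_smul' := fun c x => by ext i; exact map_smul T c (x i) }
    ‖T‖ fun x => by
      refine (sq_le_sq₀ (norm_nonneg _) (by positivity)).1 ?_
      rw [mul_pow]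
      refine hasSum_le (fun i => ?_) (hasSum_norm_sq _) ((hasSum_norm_sq x).mul_left (‖T‖ ^ 2))
      rw [← mul_pow]
      exact pow_le_pow_left₀ (norm_nonneg _) (T.le_opNorm (x i)) 2

variable {ι : Type*}

@[simp]
theorem amplification_apply (T : H →L[ℂ] H) (x : lp (fun _ : ι => H) 2) (i : ι) :
    amplification ι T x i = T (x i) := rfl

theorem amplification_add (S T : H →L[ℂ] H) :
    amplification ι (S + T) = amplification ι S + amplification ι T := by
  ext x i; simp

theorem amplification_sub (S T : H →L[ℂ] H) :
    amplification ι (S - T) = amplification ι S - amplification ι T := by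
  ext x i; simp

theorem amplification_smul (c : ℂ) (T : H →L[ℂ] H) :
    amplification ι (c • T) = c • amplification ι T := by
  ext x i; simp

variable [CompleteSpace H]

theorem inner_amplification_star (T : H →L[ℂ] H) (x y : lp (fun _ : ι => H) 2) :
    inner ℂ (amplification ι (star T) x) y = inner ℂ x (amplification ι T y) := by
  simp only [lp.inner_eq_tsum, amplification_apply, ContinuousLinearMap.star_eq_adjoint,
    ContinuousLinearMap.adjoint_inner_left]

/-- The linear map `T ↦ T x` from operators on `H` to the Hilbert sum of copies of `H`, where `T`
acts by its amplification. -/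
def orbitMap (x : lp (fun _ : ι => H) 2) : (H →L[ℂ] H) →ₗ[ℂ] lp (fun _ : ι => H) 2 where
  toFun T := amplification ι T x
  map_add' S T := by rw [amplification_add]; rfl
  map_smul' c T := by rw [amplification_smul]; rfl

/-- The closure of the set of vectors `a x`, where `x` is a vector of the Hilbert sum and `a`
runs through the amplification of `A`. -/
def cyclicSubspace (A : NonUnitalStarSubalgebra ℂ (H →L[ℂ] H)) (x : lp (fun _ : ι => H) 2) :
    Submodule ℂ (lp (fun _ : ι => H) 2) :=
  (A.toSubmodule.map (orbitMap x)).topologicalClosure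

variable (A : NonUnitalStarSubalgebra ℂ (H →L[ℂ] H)) (x : lp (fun _ : ι => H) 2)

instance : (cyclicSubspace A x).HasOrthogonalProjection :=
  haveI : CompleteSpace (cyclicSubspace A x) :=
    (Submodule.isClosed_topologicalClosure (A.toSubmodule.map (orbitMap x))).completeSpace_coe
  inferInstance

theorem mem_cyclicSubspace_iff {y : lp (fun _ : ι => H) 2} :
    y ∈ cyclicSubspace A x ↔ ∀ ε > 0, ∃ a ∈ A, dist y (amplification ι a x) < ε := by
  refine Metric.mem_closure_iff.trans (forall₂_congr fun ε _ => ⟨?_, ?_⟩)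
  · rintro ⟨_, ⟨a, ha, rfl⟩, h⟩
    exact ⟨a, ha, h⟩
  · rintro ⟨a, ha, h⟩
    exact ⟨_, ⟨a, ha, rfl⟩, h⟩

variable {A} in
theorem amplification_mem_cyclicSubspace {a : H →L[ℂ] H} (ha : a ∈ A) :
    amplification ι a x ∈ cyclicSubspace A x :=
  (mem_cyclicSubspace_iff A x).2 fun _ hε => ⟨a, ha, by simpa using hε⟩

variable {A x} in
theorem amplification_apply_mem_cyclicSubspace {a : H →L[ℂ] H} (ha : a ∈ A)
    {y : lp (fun _ : ι => H) 2} (hy : y ∈ cyclicSubspace A x) :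
    amplification ι a y ∈ cyclicSubspace A x := by
  have hmaps : Set.MapsTo (amplification ι a) (A.toSubmodule.map (orbitMap x))
      (A.toSubmodule.map (orbitMap x)) := by
    rintro _ ⟨b, hb, rfl⟩
    exact ⟨a * b, mul_mem (S := NonUnitalStarSubalgebra ℂ (H →L[ℂ] H)) ha hb, rfl⟩
  exact map_mem_closure (amplification ι a).continuous hy hmaps

variable {A x} in
theorem amplification_apply_mem_cyclicSubspace_orthogonal {a : H →L[ℂ] H} (ha : a ∈ A)
    {y : lp (fun _ : ι => H) 2} (hy : y ∈ (cyclicSubspace A x)ᗮ) :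
    amplification ι a y ∈ (cyclicSubspace A x)ᗮ := by
  rw [Submodule.mem_orthogonal] at hy ⊢
  intro z hz
  rw [← inner_amplification_star]
  exact hy _ (amplification_apply_mem_cyclicSubspace (star_mem ha) hz)

variable {A} in
-- Since `A` is closed under adjoints, both the cyclic subspace and its orthogonal complement are
-- invariant.
theorem starProjection_amplification {a : H →L[ℂ] H} (ha : a ∈ A)
    (y : lp (fun _ : ι => H) 2) :
    (cyclicSubspace A x).starProjection (amplification ι a y) =
      amplification ι a ((cyclicSubspace A x).starProjection y) := by
  refine Submodule.eq_starProjection_of_mem_orthogonal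
    (amplification_apply_mem_cyclicSubspace ha (Submodule.starProjection_apply_mem _ _)) ?_
  rw [← map_sub]
  exact amplification_apply_mem_cyclicSubspace_orthogonal ha
    (Submodule.sub_starProjection_mem_orthogonal _)

/-- `T` satisfies every identity between two matrix coefficients that holds on `A`. -/
def SatisfiesCoefficientIdentities (T : H →L[ℂ] H) : Prop :=
  ∀ u v u' v' : H, (∀ a ∈ A, inner ℂ u (a v) = inner ℂ u' (a v')) →
    inner ℂ u (T v) = inner ℂ u' (T v')

variable {A}

theorem SatisfiesCoefficientIdentities.star {T : H →L[ℂ] H}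
    (hT : SatisfiesCoefficientIdentities A T) : SatisfiesCoefficientIdentities A (star T) := by
  intro u v u' v' h
  have key : ∀ (S : H →L[ℂ] H) (p q : H),
      inner ℂ p (Star.star S q) = (starRingEnd ℂ) (inner ℂ q (S p)) := fun S p q => by
    rw [ContinuousLinearMap.star_eq_adjoint, ContinuousLinearMap.adjoint_inner_right,
      inner_conj_symm]
  rw [key, key, hT v u v' u' fun a ha => ?_]
  have := h _ (star_mem ha)
  rwa [key, key, (starRingEnd ℂ).injective.eq_iff] at this

theorem SatisfiesCoefficientIdentities.starProjection_amplification {T : H →L[ℂ] H}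
    (hT : SatisfiesCoefficientIdentities A T) (y : lp (fun _ : ι => H) 2) :
    (cyclicSubspace A x).starProjection (amplification ι T y) =
      amplification ι T ((cyclicSubspace A x).starProjection y) := by
  classical
  suffices h : (cyclicSubspace A x).starProjection ∘L amplification ι T =
      amplification ι T ∘L (cyclicSubspace A x).starProjection from DFunLike.congr_fun h y
  have hsingle : ∀ (S : H →L[ℂ] H) (j : ι) (v : H),
      amplification ι S (lp.single 2 j v) = lp.single 2 j (S v) := fun S j v => by
    ext k
    rcases eq_or_ne k j with rfl | hk
    · simp
    · simp [Pi.single_eq_of_ne hk]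
  refine lp.ext_continuousLinearMap (by norm_num) fun j => ?_
  ext v i
  simp only [ContinuousLinearMap.comp_apply, lp.singleContinuousLinearMap_apply, hsingle,
    amplification_apply]
  refine ext_inner_left ℂ fun u => ?_
  -- Self-adjointness of the projection turns its `(i, j)` block into a vector paired with `S v`, so
  -- that both sides become matrix coefficients.
  have hcoef : ∀ S : H →L[ℂ] H,
      inner ℂ u ((cyclicSubspace A x).starProjection (lp.single 2 j (S v)) i) =
      inner ℂ ((cyclicSubspace A x).starProjection (lp.single 2 i u) j) (S v) := fun S => by
    have hl := lp.inner_single_left (𝕜 := ℂ) i u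
      ((cyclicSubspace A x).starProjection (lp.single 2 j (S v)))
    have hr := lp.inner_single_right (𝕜 := ℂ) j (S v)
      ((cyclicSubspace A x).starProjection (lp.single 2 i u))
    exact hl.symm.trans ((Submodule.inner_starProjection_left_eq_right _ _ _).symm.trans hr)
  rw [hcoef]
  refine hT _ _ _ _ fun a ha => ?_
  rw [← hcoef, ← hsingle, OperatorTopology.starProjection_amplification x ha, amplification_apply]

/-- `T x = T (P x)`, where `P` is the projection onto the cyclic subspace of `x`. This does not
need `x` to lie in its cyclic subspace, which may fail if `A` is degenerate. -/
theorem SatisfiesCoefficientIdentities.amplification_starProjection {T : H →L[ℂ] H}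
    (hT : SatisfiesCoefficientIdentities A T) :
    amplification ι T ((cyclicSubspace A x).starProjection x) = amplification ι T x := by
  ext i
  refine ext_inner_left ℂ fun u => ?_
  refine hT _ _ _ _ fun a ha => ?_
  rw [← amplification_apply, ← OperatorTopology.starProjection_amplification x ha,
    Submodule.starProjection_eq_self_iff.2 (amplification_mem_cyclicSubspace x ha),
    amplification_apply]

theorem SatisfiesCoefficientIdentities.exists_norm_amplification_sub_lt {T : H →L[ℂ] H}
    (hT : SatisfiesCoefficientIdentities A T) {ε : ℝ} (hε : 0 < ε) :
    ∃ a ∈ A, ‖amplification ι (T - a) x‖ < ε := by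
  have hmem : amplification ι T x ∈ cyclicSubspace A x := by
    rw [← hT.amplification_starProjection x, ← hT.starProjection_amplification]
    exact Submodule.starProjection_apply_mem _ _
  obtain ⟨a, ha, h⟩ := (mem_cyclicSubspace_iff A x).1 hmem ε hε
  exact ⟨a, ha, by rwa [amplification_sub, sub_apply, ← dist_eq_norm]⟩

end

/-! ### Hilbert-Schmidt and trace class operators -/

noncomputable section

variable {H : Type*} [NormedAddCommGroup H] [InnerProductSpace ℂ H]

theorem hasSum_norm_inner_sq {ι : Type*} (b : HilbertBasis ι ℂ H) (x : H) :
    HasSum (fun i => ‖inner ℂ (b i) x‖ ^ 2) (‖x‖ ^ 2) := by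
  simpa [b.repr_apply_apply] using hasSum_norm_sq (b.repr x)

variable [CompleteSpace H]

/-- Parseval gives a double sum of squared matrix entries; in `ENNReal` the order of summation can
be exchanged without summability. -/
theorem tsum_ofReal_norm_sq_star {ι : Type*} (b : HilbertBasis ι ℂ H) (S : H →L[ℂ] H) :
    ∑' i, ENNReal.ofReal (‖star S (b i)‖ ^ 2) = ∑' i, ENNReal.ofReal (‖S (b i)‖ ^ 2) := by
  have parseval : ∀ x : H,
      ENNReal.ofReal (‖x‖ ^ 2) = ∑' j, ENNReal.ofReal (‖inner ℂ (b j) x‖ ^ 2) := fun x => by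
    rw [← ENNReal.ofReal_tsum_of_nonneg (fun _ => by positivity)
      (hasSum_norm_inner_sq b x).summable, (hasSum_norm_inner_sq b x).tsum_eq]
  simp_rw [parseval]
  rw [ENNReal.tsum_comm]
  refine tsum_congr fun i => tsum_congr fun j => ?_
  rw [ContinuousLinearMap.star_eq_adjoint, ContinuousLinearMap.adjoint_inner_right,
    norm_inner_symm]

theorem summable_iff_tsum_ofReal_ne_top {α : Type*} {f : α → ℝ} (hf : ∀ i, 0 ≤ f i) :
    Summable f ↔ ∑' i, ENNReal.ofReal (f i) ≠ ⊤ := by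
  refine ⟨fun h => h.tsum_ofReal_ne_top, fun h => ?_⟩
  refine (ENNReal.summable_toReal h).congr fun i => ?_
  exact ENNReal.toReal_ofReal (hf i)

theorem IsHilbertSchmidt.star {S : H →L[ℂ] H} (hS : IsHilbertSchmidt S) :
    IsHilbertSchmidt (star S) := by
  rw [IsHilbertSchmidt, summable_iff_tsum_ofReal_ne_top fun _ => by positivity] at hS ⊢
  rwa [tsum_ofReal_norm_sq_star]

theorem IsHilbertSchmidt.mul_left {S : H →L[ℂ] H} (hS : IsHilbertSchmidt S) (T : H →L[ℂ] H) :
    IsHilbertSchmidt (T * S) :=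
  Summable.of_nonneg_of_le (fun _ => by positivity)
    (fun i => (pow_le_pow_left₀ (norm_nonneg _) (T.le_opNorm (S (basis H i))) 2).trans_eq
      (mul_pow _ _ _))
    (Summable.mul_left (‖T‖ ^ 2) hS)

/-- The family of values of a Hilbert-Schmidt operator on the basis vectors. -/
def IsHilbertSchmidt.toLp {S : H →L[ℂ] H} (hS : IsHilbertSchmidt S) :
    lp (fun _ : basisIndex H => H) 2 :=
  ⟨fun i => S (basis H i), memℓp_two_iff.2 hS⟩

theorem IsHilbertSchmidt.norm_toLp_star {S : H →L[ℂ] H} (hS : IsHilbertSchmidt S) :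
    ‖hS.star.toLp‖ = ‖hS.toLp‖ := by
  have h : ∀ {R : H →L[ℂ] H} (hR : IsHilbertSchmidt R),
      ∑' i, ENNReal.ofReal (‖R (basis H i)‖ ^ 2) = ENNReal.ofReal (‖hR.toLp‖ ^ 2) := fun hR => by
    rw [← ENNReal.ofReal_tsum_of_nonneg (fun _ => by positivity) hR]
    exact congrArg _ (hasSum_norm_sq hR.toLp).tsum_eq
  have key := tsum_ofReal_norm_sq_star (basis H) S
  rw [h hS, h hS.star, ENNReal.ofReal_eq_ofReal_iff (by positivity) (by positivity)] at key
  exact (sq_eq_sq₀ (norm_nonneg _) (norm_nonneg _)).1 key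

theorem norm_abs_apply (S : H →L[ℂ] H) (x : H) : ‖CFC.abs S x‖ = ‖S x‖ := by
  have h : ∀ R : H →L[ℂ] H, inner ℂ x ((star R * R) x) = (‖R x‖ : ℂ) ^ 2 := fun R => by
    rw [ContinuousLinearMap.star_eq_adjoint, mul_apply_eq_comp,
      ContinuousLinearMap.adjoint_inner_right, inner_self_eq_norm_sq_to_K]
    rfl
  have habs : star (CFC.abs S) * CFC.abs S = star S * S := by
    rw [(CFC.abs_nonneg S).isSelfAdjoint.star_eq, CFC.abs_mul_abs]
  have := (h (CFC.abs S)).symm.trans ((congrArg (fun R => inner ℂ x (R x)) habs).trans (h S))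
  exact (sq_eq_sq₀ (norm_nonneg _) (norm_nonneg _)).1 (by exact_mod_cast this)

/-- Polar decomposition: `S = U |S|` for a bounded operator `U`. -/
theorem exists_mul_abs_eq (S : H →L[ℂ] H) : ∃ U : H →L[ℂ] H, U * CFC.abs S = S := by
  let K : Submodule ℂ H := (LinearMap.range (CFC.abs S : H →L[ℂ] H).toLinearMap).topologicalClosure
  have hK : ∀ x, CFC.abs S x ∈ K := fun x =>
    Submodule.le_topologicalClosure _ (LinearMap.mem_range_self _ x)
  have : CompleteSpace K := (Submodule.isClosed_topologicalClosure _).completeSpace_coe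
  let e : H →ₗ[ℂ] K := (CFC.abs S : H →L[ℂ] H).toLinearMap.codRestrict K hK
  have he : DenseRange e := by
    intro y
    rw [Metric.mem_closure_iff]
    intro ε hε
    obtain ⟨_, ⟨x, rfl⟩, hx⟩ := Metric.mem_closure_iff.1 y.2 ε hε
    exact ⟨_, ⟨x, rfl⟩, hx⟩
  -- `|S| x ↦ S x` is isometric on the range of `|S|`; extend it to the closure, and by zero on the
  -- complement.
  refine ⟨S.toLinearMap.extendOfNorm e ∘L K.orthogonalProjectionOnto, ?_⟩
  ext x
  have hx : K.orthogonalProjectionOnto (CFC.abs S x) = e x :=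
    Submodule.orthogonalProjectionOnto_mem_subspace_eq_self (e x)
  rw [mul_apply_eq_comp, ContinuousLinearMap.comp_apply, hx]
  refine LinearMap.extendOfNorm_eq he ⟨1, fun z => ?_⟩ x
  rw [one_mul]
  exact (norm_abs_apply S z).ge

/-- For a trace class operator `S`, the series defining `tr (S T)` converges, and `|tr (S T)|` is
bounded by an ultrastrong seminorm of `T*`. -/
theorem IsTraceClass.exists_summable_norm_trace_le {S : H →L[ℂ] H} (hS : IsTraceClass S) :
    ∃ (x : lp (fun _ : basisIndex H => H) 2) (C : ℝ), ∀ T : H →L[ℂ] H,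
      Summable (fun i => inner ℂ (basis H i) ((S * T) (basis H i))) ∧
      ‖trace (S * T)‖ ≤ C * ‖amplification (basisIndex H) (star T) x‖ := by
  obtain ⟨U, hU⟩ := exists_mul_abs_eq S
  set R := CFC.sqrt (CFC.abs S) with hR
  have hHS : IsHilbertSchmidt R := hS
  have hRR : R * R = CFC.abs S := CFC.sqrt_mul_sqrt_self _ (CFC.abs_nonneg S)
  have hstar : star R = R := (CFC.sqrt_nonneg (CFC.abs S)).isSelfAdjoint.star_eq
  have hUR : IsHilbertSchmidt (star (U * R)) := (hHS.mul_left U).star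
  refine ⟨hHS.toLp, ‖hUR.toLp‖, fun T => ?_⟩
  have hTR : IsHilbertSchmidt (star T * R) := hHS.mul_left (star T)
  -- From `S = U R R`, the trace is the Hilbert-Schmidt pairing of `(U R)*` with `R T = (T* R)*`;
  -- Cauchy-Schwarz then applies.
  have hterm : ∀ i, inner ℂ (basis H i) ((S * T) (basis H i)) =
      inner ℂ (hUR.toLp i) (hTR.star.toLp i) := fun i => by
    change _ = inner ℂ (star (U * R) (basis H i)) (star (star T * R) (basis H i))
    rw [ContinuousLinearMap.star_eq_adjoint (U * R), ContinuousLinearMap.adjoint_inner_left,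
      star_mul, star_star, hstar, ← mul_apply_eq_comp, ← hU, ← hRR]
    rfl
  have hsum := lp.hasSum_inner (𝕜 := ℂ) hUR.toLp hTR.star.toLp
  simp_rw [← hterm] at hsum
  refine ⟨hsum.summable, ?_⟩
  rw [trace, hsum.tsum_eq]
  refine (norm_inner_le_norm _ _).trans_eq ?_
  rw [hTR.norm_toLp_star]
  rfl

theorem isHilbertSchmidt_rankOne (x y : H) :
    IsHilbertSchmidt (InnerProductSpace.rankOne ℂ x y) := by
  refine ((hasSum_norm_inner_sq (basis H) y).summable.mul_right (‖x‖ ^ 2)).congr fun i => ?_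
  rw [InnerProductSpace.rankOne_apply, norm_smul, mul_pow, norm_inner_symm]

theorem IsHilbertSchmidt.smul {S : H →L[ℂ] H} (hS : IsHilbertSchmidt S) (c : ℝ) :
    IsHilbertSchmidt (c • S) := by
  refine (Summable.mul_left (‖c‖ ^ 2) hS).congr fun i => ?_
  rw [smul_apply, norm_smul, mul_pow]

theorem sqrt_smul_rankOne_self {c : ℝ} (hc : 0 ≤ c) (y : H) :
    CFC.sqrt (c • InnerProductSpace.rankOne ℂ y y) =
      (√c * ‖y‖⁻¹) • InnerProductSpace.rankOne ℂ y y := by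
  have hpos : 0 ≤ InnerProductSpace.rankOne ℂ y y :=
    (ContinuousLinearMap.nonneg_iff_isPositive _).2 (InnerProductSpace.isPositive_rankOne_self y)
  refine CFC.sqrt_unique ?_ (smul_nonneg (by positivity) hpos)
  -- The factor `‖y‖⁻¹` normalises `y`; for `y = 0` both sides vanish.
  rcases eq_or_ne y 0 with rfl | hy
  · simp
  have hmul : InnerProductSpace.rankOne ℂ y y * InnerProductSpace.rankOne ℂ y y =
      (‖y‖ ^ 2 : ℝ) • InnerProductSpace.rankOne ℂ y y := by
    rw [ContinuousLinearMap.mul_def, InnerProductSpace.rankOne_comp_rankOne,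
      inner_self_eq_norm_sq_to_K]
    ext z
    simp [← Complex.coe_smul]
  rw [smul_mul_smul_comm, hmul, smul_smul]
  congr 1
  have := norm_ne_zero_iff.2 hy
  field_simp
  exact Real.sq_sqrt hc

theorem isTraceClass_rankOne (x y : H) : IsTraceClass (InnerProductSpace.rankOne ℂ x y) := by
  have h : star (InnerProductSpace.rankOne ℂ x y) * InnerProductSpace.rankOne ℂ x y =
      (‖x‖ ^ 2 : ℝ) • InnerProductSpace.rankOne ℂ y y := by
    rw [ContinuousLinearMap.star_eq_adjoint, InnerProductSpace.adjoint_rankOne,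
      ContinuousLinearMap.mul_def, InnerProductSpace.rankOne_comp_rankOne,
      inner_self_eq_norm_sq_to_K]
    ext z
    simp [← Complex.coe_smul]
  rw [IsTraceClass, CFC.abs, h, sqrt_smul_rankOne_self (by positivity),
    sqrt_smul_rankOne_self (by positivity)]
  exact (isHilbertSchmidt_rankOne y y).smul _

/-- This makes each weak functional an ultraweak one. -/
theorem trace_rankOne_mul (x y : H) (T : H →L[ℂ] H) :
    trace (InnerProductSpace.rankOne ℂ x y * T) = inner ℂ y (T x) := by
  rw [← ContinuousLinearMap.adjoint_inner_left, ← ((basis H).hasSum_inner_mul_inner _ _).tsum_eq]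
  refine tsum_congr fun i => ?_
  rw [mul_apply_eq_comp, InnerProductSpace.inner_right_rankOne_apply,
    ContinuousLinearMap.adjoint_inner_left, mul_comm]

end

/-! ### Comparison of the topologies and closures -/

noncomputable section

theorem mem_closure_induced_pi_iff {X κ E : Type*} [SeminormedAddCommGroup E] (f : X → κ → E)
    {s : Set X} {x : X} :
    x ∈ closure[TopologicalSpace.induced f Pi.topologicalSpace] s ↔
      ∀ (F : Finset κ) (ε : ℝ), 0 < ε → ∃ y ∈ s, ∀ k ∈ F, ‖f x k - f y k‖ < ε := by
  rw [closure_induced, mem_closure_iff_nhds]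
  constructor
  · intro h F ε hε
    obtain ⟨_, hz, y, hy, rfl⟩ := h (Set.pi (F : Set κ) fun k => Metric.ball (f x k) ε)
      (set_pi_mem_nhds F.finite_toSet fun k _ => Metric.ball_mem_nhds _ hε)
    refine ⟨y, hy, fun k hk => ?_⟩
    rw [← dist_eq_norm, dist_comm]
    exact hz k hk
  · intro h t ht
    rw [nhds_pi, Filter.mem_pi] at ht
    obtain ⟨I, hI, u, hu, hsub⟩ := ht
    choose ε hε hball using fun k => Metric.mem_nhds_iff.1 (hu k)
    obtain ⟨δ, hδ, hle⟩ : ∃ δ > 0, ∀ k ∈ hI.toFinset, δ ≤ ε k := by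
      rcases hI.toFinset.eq_empty_or_nonempty with h0 | hne
      · exact ⟨1, one_pos, by simp [h0]⟩
      · obtain ⟨k, -, hk⟩ := hI.toFinset.exists_min_image ε hne
        exact ⟨ε k, hε k, hk⟩
    obtain ⟨y, hy, hlt⟩ := h hI.toFinset δ hδ
    refine ⟨f y, hsub fun k hk => hball k ?_, y, hy, rfl⟩
    have hk' := hI.mem_toFinset.2 hk
    rw [Metric.mem_ball, dist_comm, dist_eq_norm]
    exact (hlt k hk').trans_le (hle k hk')

theorem continuous_apply_induced_pi {X κ : Type*} {E : κ → Type*} [∀ k, TopologicalSpace (E k)]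
    (f : X → ∀ k, E k) (k : κ) :
    Continuous[TopologicalSpace.induced f Pi.topologicalSpace, _] fun x => f x k := by
  let _ := TopologicalSpace.induced f Pi.topologicalSpace
  exact (continuous_apply k).comp continuous_induced_dom

variable {H : Type*} [NormedAddCommGroup H] [InnerProductSpace ℂ H]

theorem strong_eq_induced :
    strong H = TopologicalSpace.induced (fun (T : H →L[ℂ] H) (x : H) => T x)
      Pi.topologicalSpace :=
  (congrArg (TopologicalSpace.induced _) (PointwiseConvergenceCLM.isEmbedding_coeFn
    (σ := RingHom.id ℂ) (E := H) (F := H)).eq_induced).trans induced_compose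

variable [CompleteSpace H]

theorem isInducing_inner_wot :
    IsInducing fun (T : H →WOT[ℂ] H) (p : H × H) => inner ℂ p.2 (T p.1) := by
  refine ⟨le_antisymm ?_ ?_⟩
  · refine continuous_iff_le_induced.1 (continuous_pi fun p => ?_)
    exact ContinuousLinearMapWOT.continuous_iff.1 continuous_id p.1 p.2
  · refine continuous_id_iff_le.1 ?_
    refine (@ContinuousLinearMapWOT.continuous_iff _ _ _ _ _ _ _ _ _ _ _ (_) _).2 fun x y => ?_
    exact continuous_apply_induced_pi
      (fun (T : H →WOT[ℂ] H) (p : H × H) => inner ℂ p.2 (T p.1)) (x, y)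

theorem weak_eq_induced :
    weak H = TopologicalSpace.induced (fun (T : H →L[ℂ] H) (p : H × H) => inner ℂ p.2 (T p.1))
      Pi.topologicalSpace :=
  (congrArg (TopologicalSpace.induced _) isInducing_inner_wot.eq_induced).trans induced_compose

theorem continuous_weak_inner (x y : H) :
    Continuous[weak H, _] fun T : H →L[ℂ] H => inner ℂ y (T x) := by
  rw [weak_eq_induced]
  exact continuous_apply_induced_pi
    (fun (T : H →L[ℂ] H) (p : H × H) => inner ℂ p.2 (T p.1)) (x, y)

theorem strong_le_weak : strong H ≤ weak H := by
  rw [weak_eq_induced, strong_eq_induced]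
  refine continuous_iff_le_induced.1 (@continuous_pi _ _ _ (_) _ _ fun p => ?_)
  exact @Continuous.comp _ _ _ (_) _ _ _ _ (continuous_const.inner continuous_id)
    (continuous_apply_induced_pi (fun (T : H →L[ℂ] H) (x : H) => T x) p.1)

theorem ultraweak_le_weak : ultraweak H ≤ weak H := by
  rw [weak_eq_induced]
  refine continuous_iff_le_induced.1 (@continuous_pi _ _ _ (_) _ _ fun p => ?_)
  simp_rw [← trace_rankOne_mul]
  exact continuous_apply_induced_pi
    (fun (T : H →L[ℂ] H) (S : {S : H →L[ℂ] H // IsTraceClass S}) => trace ((S : H →L[ℂ] H) * T))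
    ⟨_, isTraceClass_rankOne p.1 p.2⟩

variable {A : NonUnitalStarSubalgebra ℂ (H →L[ℂ] H)}

theorem satisfiesCoefficientIdentities_of_mem_closure {T : H →L[ℂ] H}
    (hT : T ∈ closure[weak H] (A : Set (H →L[ℂ] H))) : SatisfiesCoefficientIdentities A T := by
  intro u v u' v' h
  let _ := weak H
  exact closure_minimal h (isClosed_eq (continuous_weak_inner v u) (continuous_weak_inner v' u')) hT

theorem SatisfiesCoefficientIdentities.mem_closure_strong {T : H →L[ℂ] H}
    (hT : SatisfiesCoefficientIdentities A T) : T ∈ closure[strong H] (A : Set (H →L[ℂ] H)) := by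
  rw [strong_eq_induced, mem_closure_induced_pi_iff]
  intro F ε hε
  let x : lp (fun _ : F => H) 2 := ⟨fun k => (k : H), memℓp_two_iff.2 (Summable.of_finite)⟩
  obtain ⟨a, ha, hlt⟩ := hT.exists_norm_amplification_sub_lt x hε
  exact ⟨a, ha, fun k hk =>
    (lp.norm_apply_le_norm (by norm_num) (amplification F (T - a) x) ⟨k, hk⟩).trans_lt hlt⟩

theorem SatisfiesCoefficientIdentities.mem_closure_ultraweak {T : H →L[ℂ] H}
    (hT : SatisfiesCoefficientIdentities A T) :
    T ∈ closure[ultraweak H] (A : Set (H →L[ℂ] H)) := by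
  rw [mem_closure_induced_pi_iff]
  intro F ε hε
  choose x C hC using fun S : {S : H →L[ℂ] H // IsTraceClass S} => S.2.exists_summable_norm_trace_le
  -- Concatenating the finitely many vectors `x S` lets one approximant serve every `S` in `F`.
  let z : lp (fun _ : F × basisIndex H => H) 2 := ⟨fun p => x p.1 p.2, memℓp_two_iff.2 <|
    (summable_prod_of_nonneg fun _ => by positivity).2
      ⟨fun S => (hasSum_norm_sq (x S)).summable, Summable.of_finite⟩⟩
  have hz : ∀ (R : H →L[ℂ] H) (S : F),
      ‖amplification (basisIndex H) R (x S)‖ ≤ ‖amplification (F × basisIndex H) R z‖ := by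
    intro R S
    refine (sq_le_sq₀ (norm_nonneg _) (norm_nonneg _)).1 ?_
    have h := hasSum_norm_sq (amplification (F × basisIndex H) R z)
    exact hasSum_le_inj (fun i => (S, i)) (fun _ _ h => (Prod.mk.inj h).2)
      (fun _ _ => by positivity) (fun _ => le_rfl)
      (hasSum_norm_sq (amplification (basisIndex H) R (x S))) h
  obtain ⟨B, hB, hCB⟩ : ∃ B > 0, ∀ S ∈ F, C S ≤ B := by
    obtain ⟨M, hM⟩ := (F.finite_toSet.image C).bddAbove
    exact ⟨max M 1, by positivity, fun S hS => (hM ⟨S, hS, rfl⟩).trans (le_max_left _ _)⟩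
  -- The trace bound involves the adjoint, so `T*` is approximated and the approximant is then
  -- starred.
  obtain ⟨a, ha, hlt⟩ := hT.star.exists_norm_amplification_sub_lt z (div_pos hε hB)
  refine ⟨Star.star a, star_mem ha, fun S hS => ?_⟩
  have hsub : trace ((S : H →L[ℂ] H) * T) - trace ((S : H →L[ℂ] H) * Star.star a) =
      trace ((S : H →L[ℂ] H) * (T - Star.star a)) := by
    rw [trace, trace, ← (hC S T).1.tsum_sub (hC S (Star.star a)).1, trace]
    refine tsum_congr fun i => ?_
    rw [← inner_sub_right, mul_sub, sub_apply]
  rw [hsub]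
  calc _ ≤ C S * ‖amplification (basisIndex H) (Star.star (T - Star.star a)) (x S)‖ := (hC S _).2
    _ ≤ B * ‖amplification (F × basisIndex H) (Star.star (T - Star.star a)) z‖ := 
      mul_le_mul (hCB S hS) (hz _ ⟨S, hS⟩) (norm_nonneg _) hB.le
    _ < B * (ε / B) := by
      rw [star_sub, star_star]
      exact mul_lt_mul_of_pos_left hlt hB
    _ = ε := mul_div_cancel₀ _ hB.ne'

end

end OperatorTopology

theorem mainTheorem9 {H : Type*} [NormedAddCommGroup H] [InnerProductSpace ℂ H] [CompleteSpace H]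
    (A : NonUnitalStarSubalgebra ℂ (H →L[ℂ] H)) :
    List.TFAE
      [IsClosed[OperatorTopology.strong H] (A : Set (H →L[ℂ] H)),
       IsClosed[OperatorTopology.weak H] (A : Set (H →L[ℂ] H)),
       IsClosed[OperatorTopology.ultraweak H] (A : Set (H →L[ℂ] H))] := by
  have key : ∀ t : TopologicalSpace (H →L[ℂ] H),
      (∀ T, OperatorTopology.SatisfiesCoefficientIdentities A T → T ∈ closure[t] (A : Set _)) →
      IsClosed[t] (A : Set (H →L[ℂ] H)) → IsClosed[OperatorTopology.weak H] (A : Set _) := by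
    intro t ht hA
    refine (@closure_subset_iff_isClosed _ (OperatorTopology.weak H) _).1 fun T hT => ?_
    rw [← @IsClosed.closure_eq _ t _ hA]
    exact ht T (OperatorTopology.satisfiesCoefficientIdentities_of_mem_closure hT)
  tfae_have 1 → 2 := key _ fun _ h => h.mem_closure_strong
  tfae_have 2 → 1 := fun h => h.mono OperatorTopology.strong_le_weak
  tfae_have 3 → 2 := key _ fun _ h => h.mem_closure_ultraweak
  tfae_have 2 → 3 := fun h => h.mono OperatorTopology.ultraweak_le_weak
  tfae_finish
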